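/- A graph $X=(V,E,s,t,{}^{-1})$ consists of a set $V$ of vertices, a set $E$ of oriented edges, maps $s,t:E\to V$ (source and target), and an involution $e\mapsto e^{-1}$ of $E$ without fixed points such that $s(e^{-1})=t(e)$ and $t(e^{-1})=s(e)$; loops and multiple edges are allowed. A path from $x$ to $y$ is a word $e_1\cdots e_n$ of consecutive edges leading from $x$ to $y$ (possibly empty if $x=y$). The graph $X$ is connected if it is nonempty and any two vertices are joined by a path; for connected $X$, an edge $e$ is a bridge if removing $e$ and $e^{-1}$ disconnects $X$, and $X$ is bridgeless if it has no bridges. The geometric realization $|X|$ is the topological space obtained from one point for each vertex and one copy of $[0,1]$ for each $e\in E$ by gluing, in the copy belonging to $e$, the point $0$ to $s(e)$ and $1$ to $t(e)$, and identifying the intervals of $e$ and $e^{-1}$ by $r\mapsto 1-r$. Two paths from $x$ to $y$ are homologous if they are related by finitely many moves of the following kinds: inserting or deleting a subword $ee^{-1}$; exchanging two adjacent subwords that are loops based at the same vertex. Write $[\![\gamma]\!]$ for the homology class of $\gamma$. Let $X$ be connected with basepoint $x_0\in V$. The maximal abelian cover $\overline X$ is the graph whose vertices (atoms) are the homology classes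 $[\![\gamma]\!]$ of paths $\gamma$ from $x_0$ to arbitrary vertices, and whose edges are the pairs $([\![\gamma]\!],e)$ with $\gamma:x_0\to s(e)$, going from $[\![\gamma]\!]$ to $[\![\gamma e]\!]$ and having inverse $([\![\gamma e]\!],e^{-1})$. Let $A$ be the set of atoms. Let $C_1(X,\mathbb R)$ be the real vector space generated by $E$ with relations $e^{-1}=-e$, with the inner product for which the edges (one from each pair $e,e^{-1}$) form an orthonormal basis. Let $Z_1(X,\mathbb R)$ be the kernel of the boundary map $\partial e=t(e)-s(e)$ into the real vector space with basis $V$. Assume that the orthogonal projection $\pi:C_1(X,\mathbb R)\to Z_1(X,\mathbb R)$ exists, i.e. $C_1=Z_1\oplus Z_1^{\perp}$; this is automatic if $Z_1(X,\mathbb R)$ is finite-dimensional, in particular if $X$ is finite. The atom map $i:A\to Z_1(X,\mathbb R)$ is given by $i([\![e_1\cdots e_n]\!])=\pi(e_1+\cdots+e_n)$. A map $f:|\overline X|\to Z_1(X,\mathbb R)$ is affine on bonds if for every edge of $\overline X$, with its parametrization $\phi:[0,1]\to|\overline X|$, there are $a,b\in Z_1(X,\mathbb R)$ with $f(\phi(r))=a+rb$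 for all $r\in[0,1]$. **Theorem.** Let $X$ be a connected graph as above. Then $i:A\to Z_1(X,\mathbb R)$ extends uniquely to a map $j:|\overline X|\to Z_1(X,\mathbb R)$ that is affine on bonds, and $j$ is continuous. If $X$ is also bridgeless, then $j$ is one-to-one. -/

import Mathlib

/-- A graph with two oppositely oriented copies of every edge: a set `V` of vertices, a set `E` of
(oriented) edges, source and target maps, and a fixed-point free involution `inv` exchanging
sources and targets.  Loops and multiple edges are allowed. -/
structure SerreGraph.{u, v} where
  V : Type u
  E : Type v
  s : E → V
  t : E → V
  inv : E → E
  s_inv : ∀ e, s (inv e) = t e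
  t_inv : ∀ e, t (inv e) = s e
  inv_inv : ∀ e, inv (inv e) = e
  inv_ne : ∀ e, inv e ≠ e

namespace SerreGraph

universe u v

variable (X : SerreGraph.{u, v})

/-! ### Geometric realization -/

/-- The gluing relation on the disjoint union of the points `v` (one for each vertex) and the
intervals `{e} × [0, 1]` (one for each oriented edge). -/
inductive Glue : ((Σ _ : X.V, Unit) ⊕ (Σ _ : X.E, unitInterval)) →
    ((Σ _ : X.V, Unit) ⊕ (Σ _ : X.E, unitInterval)) → Prop
  | source (e : X.E) : Glue (Sum.inr ⟨e, 0⟩) (Sum.inl ⟨X.s e, ()⟩)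
  | target (e : X.E) : Glue (Sum.inr ⟨e, 1⟩) (Sum.inl ⟨X.t e, ()⟩)
  | inverse (e : X.E) (r : unitInterval) :
      Glue (Sum.inr ⟨e, r⟩) (Sum.inr ⟨X.inv e, unitInterval.symm r⟩)

/-- The geometric realization `|X|`. -/
def Realization : Type (max u v) := Quot X.Glue

/-- The quotient topology of the disjoint union topology. -/
instance : TopologicalSpace X.Realization := inferInstanceAs (TopologicalSpace (Quot X.Glue))

/-- The point of `|X|` given by a vertex. -/
def Realization.vertex (v : X.V) : X.Realization := Quot.mk _ (Sum.inl ⟨v, ()⟩)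

/-- The preferred parametrization `[0, 1] → |X|` of the closed interval given by an edge. -/
def Realization.param (e : X.E) (r : unitInterval) : X.Realization := Quot.mk _ (Sum.inr ⟨e, r⟩)

/-- A map from `|X|` to a real vector space is affine on bonds if its composite with the
parametrization of each edge has the form `r ↦ a + r b`. -/
def AffineOnBonds {W : Type*} [AddCommGroup W] [Module ℝ W] (f : X.Realization → W) : Prop :=
  ∀ e : X.E, ∃ a b : W, ∀ r : unitInterval, f (Realization.param X e r) = a + (r : ℝ) • b

/-! ### Paths, connectedness, bridges -/

/-- The word `w` of edges is a path from `x` to `y`. -/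
def IsPath (x y : X.V) : List X.E → Prop
  | [] => x = y
  | e :: w => X.s e = x ∧ IsPath (X.t e) y w

/-- Paths from `x` to `y`. -/
def Path (x y : X.V) : Type v := {w : List X.E // X.IsPath x y w}

/-- `X` is connected: it is nonempty and any two vertices are joined by a path. -/
def Connected : Prop := Nonempty X.V ∧ ∀ x y : X.V, Nonempty (X.Path x y)

/-- The graph obtained from `X` by removing the edge `e` (in both orientations). -/
def deleteEdge (e : X.E) : SerreGraph.{u, v} where
  V := X.V
  E := {f : X.E // f ≠ e ∧ f ≠ X.inv e}
  s f := X.s f.1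
  t f := X.t f.1
  inv f := ⟨X.inv f.1,
    fun h => f.2.2 ((X.inv_inv f.1).symm.trans (congrArg X.inv h)),
    fun h => f.2.1 ((X.inv_inv f.1).symm.trans ((congrArg X.inv h).trans (X.inv_inv e)))⟩
  s_inv f := X.s_inv f.1
  t_inv f := X.t_inv f.1
  inv_inv f := Subtype.ext (X.inv_inv f.1)
  inv_ne f h := X.inv_ne f.1 (congrArg Subtype.val h)

/-- A bridge of a connected graph is an edge whose removal disconnects the graph. -/
def IsBridge (e : X.E) : Prop := ¬ (X.deleteEdge e).Connected

def Bridgeless : Prop := ∀ e : X.E, ¬ X.IsBridge e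

variable {X}

theorem IsPath.append {x y z : X.V} {w w' : List X.E} (h : X.IsPath x y w)
    (h' : X.IsPath y z w') : X.IsPath x z (w ++ w') := by
  induction w generalizing x with
  | nil => cases h; exact h'
  | cons e w ih => exact ⟨h.1, ih h.2⟩

variable (X)

/-! ### Homology classes of paths and the maximal abelian cover -/

/-- The elementary moves on words: introducing a subword `e e⁻¹`, and exchanging two adjacent
subwords that are loops based at the same vertex. -/
inductive HomologyMove : List X.E → List X.E → Prop
  | cancel (p q : List X.E) (e : X.E) :
      HomologyMove (p ++ q) (p ++ [e, X.inv e] ++ q)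
  | swap (p a b q : List X.E) (v : X.V) (ha : X.IsPath v v a) (hb : X.IsPath v v b) :
      HomologyMove (p ++ a ++ b ++ q) (p ++ b ++ a ++ q)

/-- Two paths from `x` to `y` are homologous if they are connected by a finite sequence of moves
and inverses of moves. -/
def homologous (x y : X.V) : Setoid (X.Path x y) :=
  Relation.EqvGen.setoid fun γ δ => X.HomologyMove γ.1 δ.1

/-- Homology classes of paths from `x` to `y`. -/
def HomologyClass (x y : X.V) : Type v := Quotient (X.homologous x y)

variable {X}

theorem HomologyMove.append_right {w w' : List X.E} (h : X.HomologyMove w w') (r : List X.E) :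
    X.HomologyMove (w ++ r) (w' ++ r) := by
  cases h with
  | cancel p q e => simpa using HomologyMove.cancel p (q ++ r) e
  | swap p a b q v ha hb => simpa using HomologyMove.swap p a b (q ++ r) v ha hb

/-- The path `γ e`. -/
def Path.snoc {x y z : X.V} (γ : X.Path x y) (e : X.E) (hs : X.s e = y) (ht : X.t e = z) :
    X.Path x z :=
  ⟨γ.1 ++ [e], γ.2.append ⟨hs, ht⟩⟩

theorem Path.snoc_homologous {x y z : X.V} {γ δ : X.Path x y} (h : X.homologous x y γ δ)
    (e : X.E) (hs : X.s e = y) (ht : X.t e = z) :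
    X.homologous x z (γ.snoc e hs ht) (δ.snoc e hs ht) := by
  change Relation.EqvGen _ _ _
  change Relation.EqvGen _ _ _ at h
  induction h with
  | rel γ δ h => exact .rel _ _ (h.append_right [e])
  | refl γ => exact .refl _
  | symm γ δ _ ih => exact .symm _ _ ih
  | trans γ δ ε _ _ ih₁ ih₂ => exact .trans _ _ _ ih₁ ih₂

/-- The homology class of `γ e`, as a function of the homology class of `γ`. -/
def HomologyClass.snoc {x y z : X.V} (a : X.HomologyClass x y) (e : X.E) (hs : X.s e = y)
    (ht : X.t e = z) : X.HomologyClass x z :=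
  Quotient.map (fun γ => γ.snoc e hs ht) (fun _ _ h => Path.snoc_homologous h e hs ht) a

theorem HomologyClass.snoc_snoc_inv {x y z : X.V} (a : X.HomologyClass x y) (e : X.E)
    (hs : X.s e = y) (ht : X.t e = z) (hs' : X.s (X.inv e) = z) (ht' : X.t (X.inv e) = y) :
    (a.snoc e hs ht).snoc (X.inv e) hs' ht' = a := by
  induction a using Quotient.inductionOn with
  | _ γ =>
    refine Quotient.sound ?_
    refine Relation.EqvGen.symm _ _ (Relation.EqvGen.rel _ _ ?_)
    simpa [Path.snoc] using HomologyMove.cancel γ.1 [] e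

variable (X)

/-- The atoms: homology classes of paths from the basepoint `x₀` to an arbitrary vertex. -/
def Atom (x₀ : X.V) : Type (max u v) := Σ x : X.V, X.HomologyClass x₀ x

theorem atom_ext_snoc {x₀ y z z' : X.V} (a : X.HomologyClass x₀ y) (e : X.E) (hs : X.s e = y)
    (ht : X.t e = z) (ht' : X.t e = z') :
    (⟨z, a.snoc e hs ht⟩ : X.Atom x₀) = ⟨z', a.snoc e hs ht'⟩ := by
  cases ht; cases ht'; rfl

theorem atom_ext_snoc_snoc {x₀ y z w : X.V} (a : X.HomologyClass x₀ y) (e : X.E)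
    (hs : X.s e = y) (ht : X.t e = z) (hs' : X.s (X.inv e) = z) (ht' : X.t (X.inv e) = w) :
    (⟨w, (a.snoc e hs ht).snoc (X.inv e) hs' ht'⟩ : X.Atom x₀) = ⟨y, a⟩ := by
  have h : w = y := by rw [← ht', X.t_inv, hs]
  cases h
  rw [HomologyClass.snoc_snoc_inv]

/-- The oriented edges of the maximal abelian cover: an edge `e : x → y` of `X` together with a
homology class `⟦γ⟧ : x₀ → x`.  It goes from the atom `⟦γ⟧` to the atom `⟦γ e⟧`. -/
def CoverEdge (x₀ : X.V) : Type v := Σ e : X.E, X.HomologyClass x₀ (X.s e)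

theorem coverEdge_ext {x₀ : X.V} {e f : X.E} (h : e = f) (a : X.HomologyClass x₀ (X.s e))
    (b : X.HomologyClass x₀ (X.s f))
    (hab : (⟨X.s e, a⟩ : X.Atom x₀) = ⟨X.s f, b⟩) :
    (⟨e, a⟩ : X.CoverEdge x₀) = ⟨f, b⟩ := by
  cases h
  cases hab
  rfl

/-- The maximal abelian cover of a connected graph `X` with basepoint `x₀`.  The inverse of the
edge given by `e` and `⟦γ⟧` is given by `e⁻¹` and `⟦γ e⟧`. -/
def maxAbelianCover (x₀ : X.V) : SerreGraph.{max u v, v} where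
  V := X.Atom x₀
  E := X.CoverEdge x₀
  s b := ⟨X.s b.1, b.2⟩
  t b := ⟨X.t b.1, b.2.snoc b.1 rfl rfl⟩
  inv b := ⟨X.inv b.1, b.2.snoc b.1 rfl (X.s_inv b.1).symm⟩
  s_inv _ := X.atom_ext_snoc _ _ _ _ _
  t_inv _ := X.atom_ext_snoc_snoc _ _ _ _ _ _
  inv_inv b := X.coverEdge_ext (X.inv_inv b.1) _ _ (X.atom_ext_snoc_snoc _ _ _ _ _ _)
  inv_ne b h := X.inv_ne b.1 (congrArg Sigma.fst h)

/-! ### Chains, cycles and the inner product -/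

noncomputable section

/-- The subspace spanned by the relations `e⁻¹ = -e`. -/
def chainRelations : Submodule ℝ (X.E →₀ ℝ) :=
  Submodule.span ℝ (Set.range fun e : X.E =>
    Finsupp.single (X.inv e) (1 : ℝ) + Finsupp.single e (1 : ℝ))

/-- The space `C₁(X, ℝ)` of 1-chains. -/
def C1 : Type v := (X.E →₀ ℝ) ⧸ X.chainRelations

instance : AddCommGroup X.C1 := inferInstanceAs (AddCommGroup ((X.E →₀ ℝ) ⧸ X.chainRelations))

instance : Module ℝ X.C1 := inferInstanceAs (Module ℝ ((X.E →₀ ℝ) ⧸ X.chainRelations))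

/-- The quotient map from formal combinations of oriented edges to 1-chains. -/
def toC1 : (X.E →₀ ℝ) →ₗ[ℝ] X.C1 := X.chainRelations.mkQ

/-- An edge, seen as a 1-chain. -/
def edgeChain (e : X.E) : X.C1 := X.toC1 (Finsupp.single e 1)

theorem toC1_surjective : Function.Surjective X.toC1 := X.chainRelations.mkQ_surjective

theorem edgeChain_inv (e : X.E) : X.edgeChain (X.inv e) = -X.edgeChain e := by
  rw [eq_neg_iff_add_eq_zero, edgeChain, edgeChain, ← map_add]
  exact (Submodule.Quotient.mk_eq_zero _).2 (Submodule.subset_span ⟨e, rfl⟩)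

/-- A linear map out of `C₁(X, ℝ)`, from a function on edges with `g (e⁻¹) = - g e`. -/
def C1.lift {W : Type*} [AddCommGroup W] [Module ℝ W] (g : X.E → W)
    (hg : ∀ e, g (X.inv e) = -g e) : X.C1 →ₗ[ℝ] W :=
  X.chainRelations.liftQ (Finsupp.linearCombination ℝ g) <| by
    rw [chainRelations, Submodule.span_le]
    rintro _ ⟨e, rfl⟩
    simp [hg]

theorem C1.lift_toC1 {W : Type*} [AddCommGroup W] [Module ℝ W] (g : X.E → W)
    (hg : ∀ e, g (X.inv e) = -g e) (f : X.E →₀ ℝ) :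
    C1.lift X g hg (X.toC1 f) = Finsupp.linearCombination ℝ g f := rfl

theorem C1.lift_edgeChain {W : Type*} [AddCommGroup W] [Module ℝ W] (g : X.E → W)
    (hg : ∀ e, g (X.inv e) = -g e) (e : X.E) :
    C1.lift X g hg (X.edgeChain e) = g e := by
  simp [edgeChain, C1.lift_toC1]

/-- The coefficients of a 1-chain: the edge `e` has coefficient `1` at `e`, coefficient `-1` at
`e⁻¹`, and coefficient `0` at all other edges. -/
def C1.coeff : X.C1 →ₗ[ℝ] (X.E →₀ ℝ) :=
  C1.lift X (fun e => Finsupp.single e 1 - Finsupp.single (X.inv e) 1) (by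
    intro e; simp [X.inv_inv])

theorem C1.toC1_coeff (c : X.C1) : X.toC1 (C1.coeff X c) = (2 : ℝ) • c := by
  have h : X.toC1 ∘ₗ C1.coeff X ∘ₗ X.toC1 = (2 : ℝ) • X.toC1 := by
    ext e
    have h1 := C1.lift_edgeChain X (fun e => Finsupp.single e (1 : ℝ) -
      Finsupp.single (X.inv e) 1) (by intro e; simp [X.inv_inv]) e
    have h2 : C1.coeff X (X.edgeChain e) = _ := h1
    change X.toC1 (C1.coeff X (X.edgeChain e)) = (2 : ℝ) • X.edgeChain e
    rw [h2, map_sub]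
    change X.edgeChain e - X.edgeChain (X.inv e) = _
    rw [X.edgeChain_inv, sub_neg_eq_add, two_smul]
  obtain ⟨f, rfl⟩ := X.toC1_surjective c
  exact LinearMap.congr_fun h f

theorem C1.coeff_injective : Function.Injective (C1.coeff X) := by
  intro c d h
  have h' := congrArg X.toC1 h
  rw [C1.toC1_coeff, C1.toC1_coeff] at h'
  exact smul_right_injective _ (two_ne_zero (α := ℝ)) h'

/-- The inner product on 1-chains for which the edges (one from each pair `e, e⁻¹`) form an
orthonormal basis: half the sum, over all oriented edges, of the products of the coefficients. -/
@[reducible] def C1.innerCore : InnerProductSpace.Core ℝ X.C1 where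
  inner c d := (1 / 2 : ℝ) * (C1.coeff X c).sum fun e r => r * C1.coeff X d e
  conj_inner_symm c d := by
    classical
    simp only [conj_trivial]
    congr 1
    rw [Finsupp.sum_of_support_subset (C1.coeff X d) (Finset.subset_union_right
        (s₁ := (C1.coeff X c).support)) _ (by simp),
      Finsupp.sum_of_support_subset (C1.coeff X c) (Finset.subset_union_left
        (s₂ := (C1.coeff X d).support)) _ (by simp)]
    exact Finset.sum_congr rfl fun e _ => mul_comm _ _
  re_inner_nonneg c := by
    simp only [RCLike.re_to_real]
    exact mul_nonneg (by norm_num) (Finset.sum_nonneg fun e _ => mul_self_nonneg _)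
  add_left c d c' := by
    rw [map_add, Finsupp.sum_add_index' (by simp) (by intros; ring), mul_add]
  smul_left c d r := by
    rw [map_smul, Finsupp.sum_smul_index (by simp), Finsupp.sum, Finsupp.sum]
    simp only [conj_trivial, mul_assoc, ← Finset.mul_sum]
    ring
  definite c h := by
    apply C1.coeff_injective X
    rw [map_zero]
    have h' : ((C1.coeff X c).sum fun e r => r * C1.coeff X c e) = 0 := by
      simpa using h
    rw [Finsupp.sum, Finset.sum_eq_zero_iff_of_nonneg fun e _ => mul_self_nonneg _] at h'
    ext e
    by_contra hne
    exact hne (mul_self_eq_zero.1 (h' e (Finsupp.mem_support_iff.2 hne)))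

instance : NormedAddCommGroup X.C1 :=
  @InnerProductSpace.Core.toNormedAddCommGroup ℝ X.C1 _ _ _ (C1.innerCore X)

instance : InnerProductSpace ℝ X.C1 := InnerProductSpace.ofCore (C1.innerCore X).toCore

open Classical in
theorem inner_edgeChain (e f : X.E) :
    inner ℝ (X.edgeChain e) (X.edgeChain f) =
      if f = e then 1 else if f = X.inv e then -1 else (0 : ℝ) := by
  have hc : ∀ e, C1.coeff X (X.edgeChain e) =
      Finsupp.single e 1 - Finsupp.single (X.inv e) 1 := fun e => C1.lift_edgeChain X _ _ e
  change (1 / 2 : ℝ) * (C1.coeff X (X.edgeChain e)).sum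
    (fun a r => r * C1.coeff X (X.edgeChain f) a) = _
  rw [hc, hc, Finsupp.sum_sub_index (by intros; ring), Finsupp.sum_single_index (by simp),
    Finsupp.sum_single_index (by simp)]
  have h1 := X.inv_ne e
  have h2 := X.inv_ne f
  have h3 := X.inv_inv e
  have h4 := X.inv_inv f
  simp only [Finsupp.sub_apply, Finsupp.single_apply]
  by_cases hfe : f = e
  · subst hfe; simp [h1, h1.symm]; norm_num
  · by_cases hfi : f = X.inv e
    · subst hfi; simp [h1, h1.symm, h3]; norm_num
    · have h5 : X.inv f ≠ e := fun h => hfi (by rw [← h, h4])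
      have h6 : X.inv f ≠ X.inv e := fun h => hfe (by rw [← h4, h, h3])
      simp [hfe, hfi, h5, h6]

/-- If there are finitely many edges, the space of 1-chains is finite-dimensional. -/
instance [Finite X.E] : FiniteDimensional ℝ X.C1 :=
  Module.Finite.of_surjective X.toC1 X.toC1_surjective

/-- The boundary map `∂ e = t(e) - s(e)` from 1-chains to 0-chains. -/
def boundary : X.C1 →ₗ[ℝ] (X.V →₀ ℝ) :=
  C1.lift X (fun e => Finsupp.single (X.t e) 1 - Finsupp.single (X.s e) 1) (by
    intro e; simp [X.s_inv, X.t_inv])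

/-- The space `Z₁(X, ℝ)` of 1-cycles. -/
def Z1 : Submodule ℝ X.C1 := LinearMap.ker X.boundary

/-- The 1-chain `c_γ = e₁ + ⋯ + eₙ` of a path `γ = e₁ ⋯ eₙ`. -/
def wordChain (w : List X.E) : X.C1 := (w.map X.edgeChain).sum

theorem HomologyMove.wordChain_eq {w w' : List X.E} (h : X.HomologyMove w w') :
    X.wordChain w = X.wordChain w' := by
  cases h with
  | cancel p q e => simp [wordChain, X.edgeChain_inv]
  | swap p a b q v ha hb => simp only [wordChain, List.map_append, List.sum_append]; abel

theorem wordChain_eq_of_homologous {x y : X.V} {γ δ : X.Path x y} (h : X.homologous x y γ δ) :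
    X.wordChain γ.1 = X.wordChain δ.1 := by
  change Relation.EqvGen _ _ _ at h
  induction h with
  | rel γ δ h => exact h.wordChain_eq
  | refl γ => rfl
  | symm γ δ _ ih => exact ih.symm
  | trans γ δ ε _ _ ih₁ ih₂ => exact ih₁.trans ih₂

/-- The atom map `i : A → Z₁(X, ℝ)`, sending `⟦α⟧` to `π(c_α)`, where `π` is the orthogonal
projection of `C₁(X, ℝ)` onto `Z₁(X, ℝ)`. -/
def atomMap (x₀ : X.V) [X.Z1.HasOrthogonalProjection] (a : X.Atom x₀) : X.Z1 :=
  Quotient.lift (fun γ : X.Path x₀ a.1 => X.Z1.orthogonalProjectionOnto (X.wordChain γ.1))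
    (fun _ _ h => by rw [X.wordChain_eq_of_homologous h]) a.2

/-- `j : |X̄| → Z₁(X, ℝ)` extends the atom map and is affine on bonds. -/
def IsCrystalMap (x₀ : X.V) [X.Z1.HasOrthogonalProjection]
    (j : (X.maxAbelianCover x₀).Realization → X.Z1) : Prop :=
  (∀ a : X.Atom x₀, j (Realization.vertex (X.maxAbelianCover x₀) a) = X.atomMap x₀ a) ∧
    (X.maxAbelianCover x₀).AffineOnBonds j

end

end SerreGraph

/-! A map that is affine on bonds is fixed on each edge by its values at the two ends. This gives
existence and uniqueness of `j` at once, and continuity follows from the quotient topology. The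
content is injectivity. The point at parameter `r` on the edge of the cover given by `e` and `⟦γ⟧`
goes to `π(c_γ + r e)`, so injectivity splits into two claims about such chains.

Chains determine points (`coverPoint_eq`). For paths with common ends, a zero difference of chains
implies homology (`homologousWords_of_wordChain_eq`). Indeed a loop is homologous, up to
conjugation, to a product of loops at `x₀`, each running through a single edge. These loops commute
and the loops of `e` and `e⁻¹` cancel, so only net edge counts matter. For interior points, the edge
and the parameter are read off from the one non-integral coefficient.

Projections determine chains if there are no bridges (`wordChain_add_smul_eq`). The difference `c`
of two such chains with equal projection is orthogonal to all cycles, hence the coboundary of a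
potential `f` (`exists_potential`). If `c ≠ 0`, a superlevel set `S` of `f` is crossed by `c` only
inwards and, as there are no bridges, along at least two edges (`exists_cut`). The flux of `c` into
`S` is the difference of the masses which the two points, spread linearly over the ends of their
edges, have in `S`; so it is at most 1. But the coefficients of `c` are integers away from the two
edges carrying the points, and the positive coefficients on the two crossing edges always add up to
more than this flux, a contradiction. -/

namespace SerreGraph

universe u v

variable {X : SerreGraph.{u, v}}

/-! ### Words up to homology -/

/-- The word `eₙ⁻¹ ⋯ e₁⁻¹` inverse to `e₁ ⋯ eₙ`. -/
def invWord (X : SerreGraph.{u, v}) (w : List X.E) : List X.E := (w.map X.inv).reverse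

theorem invWord_cons (e : X.E) (w : List X.E) : X.invWord (e :: w) = X.invWord w ++ [X.inv e] := by
  simp [invWord]

theorem invWord_invWord (w : List X.E) : X.invWord (X.invWord w) = w := by
  simp [invWord, Function.comp_def, X.inv_inv]

theorem IsPath.invWord {x y : X.V} {w : List X.E} (h : X.IsPath x y w) :
    X.IsPath y x (X.invWord w) := by
  induction w generalizing x with
  | nil => exact Eq.symm h
  | cons e w ih =>
    rw [invWord_cons]
    exact (ih h.2).append ⟨X.s_inv e, (X.t_inv e).trans h.1⟩

theorem isPath_singleton (e : X.E) : X.IsPath (X.s e) (X.t e) [e] := ⟨rfl, rfl⟩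

/-- Both words are paths from `x` to `y`, and these paths are homologous. -/
def HomologousWords (X : SerreGraph.{u, v}) (x y : X.V) (w w' : List X.E) : Prop :=
  ∃ (h : X.IsPath x y w) (h' : X.IsPath x y w'), X.homologous x y ⟨w, h⟩ ⟨w', h'⟩

namespace HomologousWords

variable {x y z v : X.V} {p q w w' w'' : List X.E}

theorem refl (h : X.IsPath x y w) : X.HomologousWords x y w w :=
  ⟨h, h, (X.homologous x y).refl _⟩

theorem symm (h : X.HomologousWords x y w w') : X.HomologousWords x y w' w := by
  obtain ⟨h₁, h₂, h⟩ := h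
  exact ⟨h₂, h₁, (X.homologous x y).symm h⟩

theorem trans (h : X.HomologousWords x y w w') (h' : X.HomologousWords x y w' w'') :
    X.HomologousWords x y w w'' := by
  obtain ⟨h₁, h₂, h⟩ := h
  obtain ⟨h₃, h₄, h'⟩ := h'
  exact ⟨h₁, h₄, (X.homologous x y).trans h h'⟩

theorem of_move (h₁ : X.IsPath x y w) (h₂ : X.IsPath x y w') (h : X.HomologyMove w w') :
    X.HomologousWords x y w w' :=
  ⟨h₁, h₂, Relation.EqvGen.rel _ _ h⟩

theorem append_left (hp : X.IsPath x y p) (h : X.HomologousWords y z w w') :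
    X.HomologousWords x z (p ++ w) (p ++ w') := by
  obtain ⟨h₁, h₂, h⟩ := h
  change Relation.EqvGen _ _ _ at h
  refine ⟨hp.append h₁, hp.append h₂, ?_⟩
  change Relation.EqvGen _ _ _
  -- Stated for arbitrary paths, so that induction on the generated equivalence does not fix the two
  -- words.
  have key : ∀ γ δ : X.Path y z,
      Relation.EqvGen (fun γ δ : X.Path y z => X.HomologyMove γ.1 δ.1) γ δ →
      Relation.EqvGen (fun γ δ : X.Path x z => X.HomologyMove γ.1 δ.1)
        ⟨p ++ γ.1, hp.append γ.2⟩ ⟨p ++ δ.1, hp.append δ.2⟩ := by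
    intro γ δ h
    induction h with
    | rel γ δ h =>
      refine .rel _ _ ?_
      dsimp only
      generalize γ.1 = a at h
      generalize δ.1 = b at h
      cases h with
      | cancel p' q e => simpa using HomologyMove.cancel (p ++ p') q e
      | swap p' a b q v ha hb => simpa using HomologyMove.swap (p ++ p') a b q v ha hb
    | refl γ => exact .refl _
    | symm γ δ _ ih => exact .symm _ _ ih
    | trans γ δ ε _ _ ih₁ ih₂ => exact .trans _ _ _ ih₁ ih₂
  exact key _ _ h

theorem append_right (h : X.HomologousWords x y w w') (hq : X.IsPath y z q) :
    X.HomologousWords x z (w ++ q) (w' ++ q) := by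
  obtain ⟨h₁, h₂, h⟩ := h
  refine ⟨h₁.append hq, h₂.append hq, ?_⟩
  have key : ∀ γ δ : X.Path x y,
      Relation.EqvGen (fun γ δ : X.Path x y => X.HomologyMove γ.1 δ.1) γ δ →
      Relation.EqvGen (fun γ δ : X.Path x z => X.HomologyMove γ.1 δ.1)
        ⟨γ.1 ++ q, γ.2.append hq⟩ ⟨δ.1 ++ q, δ.2.append hq⟩ := by
    intro γ δ h
    induction h with
    | rel γ δ h => exact .rel _ _ (h.append_right q)
    | refl γ => exact .refl _
    | symm γ δ _ ih => exact .symm _ _ ih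
    | trans γ δ ε _ _ ih₁ ih₂ => exact .trans _ _ _ ih₁ ih₂
  exact key _ _ h

theorem swap (hw : X.IsPath x x w) (hw' : X.IsPath x x w') :
    X.HomologousWords x x (w ++ w') (w' ++ w) :=
  of_move (hw.append hw') (hw'.append hw)
    (by simpa using HomologyMove.swap [] w w' [] x hw hw')

theorem append_invWord (h : X.IsPath x y w) : X.HomologousWords x x (w ++ X.invWord w) [] := by
  induction w generalizing x with
  | nil => exact refl rfl
  | cons e w ih =>
    obtain ⟨rfl, h⟩ := h
    have h₁ : X.IsPath (X.t e) (X.s e) [X.inv e] := ⟨X.s_inv e, X.t_inv e⟩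
    have h₂ := ((ih h).append_right h₁).append_left (isPath_singleton e)
    have h₃ : X.HomologousWords (X.s e) (X.s e) ([e] ++ ([] ++ [X.inv e])) [] :=
      (of_move (show X.IsPath _ _ [] from rfl) ((isPath_singleton e).append h₁)
        (HomologyMove.cancel [] [] e)).symm
    have h₄ := h₂.trans h₃
    simpa [invWord_cons] using h₄

theorem invWord_append (h : X.IsPath x y w) : X.HomologousWords y y (X.invWord w ++ w) [] := by
  simpa [invWord_invWord] using append_invWord h.invWord

end HomologousWords

/-! ### Decomposition of paths into loops through single edges -/

section Loops

variable {x₀ : X.V} (T : ∀ x : X.V, X.Path x₀ x)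

/-- The loop based at `x₀` which runs to the source of `e`, through `e`, and back, along
chosen paths `T` from `x₀` to all vertices. -/
def edgeLoop (e : X.E) : List X.E := (T (X.s e)).1 ++ [e] ++ X.invWord (T (X.t e)).1

theorem isPath_edgeLoop (e : X.E) : X.IsPath x₀ x₀ (edgeLoop T e) :=
  ((T _).2.append (isPath_singleton e)).append (T _).2.invWord

theorem isPath_flatMap_edgeLoop (w : List X.E) : X.IsPath x₀ x₀ (w.flatMap (edgeLoop T)) := by
  induction w with
  | nil => rfl
  | cons e w ih => exact (isPath_edgeLoop T e).append ih

theorem edgeLoop_append_edgeLoop_inv (e : X.E) :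
    X.HomologousWords x₀ x₀ (edgeLoop T e ++ edgeLoop T (X.inv e)) [] := by
  have h : edgeLoop T (X.inv e) = X.invWord (edgeLoop T e) := by
    rw [edgeLoop, X.s_inv, X.t_inv]
    simp [edgeLoop, invWord, Function.comp_def, X.inv_inv]
  rw [h]
  exact HomologousWords.append_invWord (isPath_edgeLoop T e)

/-- After each edge of `w`, insert the detour to `x₀` and back along the chosen path to the current
vertex; this does not change the homology class. -/
theorem homologousWords_flatMap_edgeLoop {y z : X.V} {w : List X.E} (h : X.IsPath y z w) :
    X.HomologousWords x₀ z ((T y).1 ++ w) (w.flatMap (edgeLoop T) ++ (T z).1) := by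
  induction w generalizing y with
  | nil => cases h; simpa using HomologousWords.refl (T _).2
  | cons e w ih =>
    obtain ⟨rfl, h⟩ := h
    have h₁ := ((HomologousWords.invWord_append (T (X.t e)).2).symm.append_right h).append_left
      ((T (X.s e)).2.append (isPath_singleton e))
    have h₂ := (ih h).append_left (isPath_edgeLoop T e)
    refine HomologousWords.trans (w' := edgeLoop T e ++ ((T (X.t e)).1 ++ w)) ?_ ?_
    · simpa [edgeLoop] using h₁
    · simpa using h₂

-- Loops at `x₀` commute up to homology, so the loop of the first edge can be moved next to the loop
-- of an inverse occurrence, where the two cancel. The remaining word is again balanced and shorter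
-- by two, whence induction on a bound for the length.
open Classical in
theorem homologousWords_flatMap_edgeLoop_nil (n : ℕ) (w : List X.E) (hn : w.length ≤ n)
    (hw : ∀ e, w.count e = w.count (X.inv e)) :
    X.HomologousWords x₀ x₀ (w.flatMap (edgeLoop T)) [] := by
  induction n generalizing w with
  | zero =>
    obtain rfl := List.length_eq_zero_iff.1 (Nat.le_zero.1 hn)
    exact HomologousWords.refl rfl
  | succ n ih =>
    cases w with
    | nil => exact HomologousWords.refl rfl
    | cons e w =>
      have hmem : X.inv e ∈ w := by
        have h := hw e
        rw [List.count_cons_self, List.count_cons_of_ne (X.inv_ne e).symm] at h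
        exact List.count_pos_iff.1 (by omega)
      obtain ⟨p, q, rfl⟩ := List.append_of_mem hmem
      have hpq : ∀ f, (p ++ q).count f = (p ++ q).count (X.inv f) := by
        intro f
        have h := hw f
        have h₁ : (X.inv e = f) ↔ (e = X.inv f) :=
          ⟨fun h => by rw [← h, X.inv_inv], fun h => by rw [h, X.inv_inv]⟩
        have h₂ : (e = f) ↔ (X.inv e = X.inv f) :=
          ⟨fun h => by rw [h], fun h => by rw [← X.inv_inv e, h, X.inv_inv]⟩
        simp only [List.count_append, List.count_cons, beq_iff_eq, h₁, ← h₂] at h ⊢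
        omega
      have hl : (p ++ q).length ≤ n := by simp at hn ⊢; omega
      have hp := isPath_flatMap_edgeLoop T p
      have hq := isPath_flatMap_edgeLoop T q
      have he := isPath_edgeLoop T e
      have he' := isPath_edgeLoop T (X.inv e)
      have h₁ := (HomologousWords.swap he hp).append_right (he'.append hq)
      have h₂ := ((edgeLoop_append_edgeLoop_inv T e).append_right hq).append_left hp
      have h₃ := ih (p ++ q) hl hpq
      simp only [List.flatMap_append, List.flatMap_cons, List.append_assoc, List.nil_append]
        at h₁ h₂ h₃ ⊢
      exact h₁.trans (h₂.trans h₃)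

end Loops

/-! ### Homology classes of paths are determined by their chains -/

open Classical in
theorem coeff_edgeChain (e f : X.E) : C1.coeff X (X.edgeChain e) f =
    (if e = f then 1 else 0) - (if e = X.inv f then 1 else 0) := by
  have h : C1.coeff X (X.edgeChain e) = Finsupp.single e 1 - Finsupp.single (X.inv e) 1 :=
    C1.lift_edgeChain X _ _ e
  have h₁ : (X.inv e = f) ↔ (e = X.inv f) :=
    ⟨fun h => by rw [← h, X.inv_inv], fun h => by rw [h, X.inv_inv]⟩
  simp [h, Finsupp.single_apply, h₁]

theorem coeff_inv (c : X.C1) (e : X.E) : C1.coeff X c (X.inv e) = -C1.coeff X c e := by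
  classical
  obtain ⟨f, rfl⟩ := X.toC1_surjective c
  induction f using Finsupp.induction_linear with
  | zero => simp
  | add f g hf hg => simp [hf, hg]; ring
  | single a r =>
    have h : X.toC1 (Finsupp.single a r) = r • X.edgeChain a := by
      rw [edgeChain, ← map_smul]; simp
    simp only [h, map_smul, Finsupp.smul_apply, coeff_edgeChain, X.inv_inv, smul_eq_mul]
    ring

theorem wordChain_cons (e : X.E) (w : List X.E) :
    X.wordChain (e :: w) = X.edgeChain e + X.wordChain w := by
  simp [wordChain]

theorem wordChain_append (w w' : List X.E) :
    X.wordChain (w ++ w') = X.wordChain w + X.wordChain w' := by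
  simp [wordChain]

theorem wordChain_invWord (w : List X.E) : X.wordChain (X.invWord w) = -X.wordChain w := by
  induction w with
  | nil => simp [wordChain, invWord]
  | cons e w ih =>
    rw [invWord_cons, wordChain_append, ih, wordChain_cons, wordChain_cons, edgeChain_inv]
    simp [wordChain]

open Classical in
theorem coeff_wordChain (w : List X.E) (f : X.E) :
    C1.coeff X (X.wordChain w) f = (w.count f : ℝ) - w.count (X.inv f) := by
  induction w with
  | nil => simp [wordChain]
  | cons e w ih =>
    rw [wordChain_cons, map_add, Finsupp.add_apply, ih, coeff_edgeChain]
    simp only [List.count_cons, beq_iff_eq]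
    push_cast
    ring

/-- The loop `w w'⁻¹` has chain zero, so each edge occurs in it as often as its inverse. Its product
of edge loops is therefore null-homologous, and conjugating by the chosen path to `x` shows the same
for the loop itself. -/
theorem homologousWords_of_wordChain_eq (hX : X.Connected) {x y : X.V} {w w' : List X.E}
    (h : X.IsPath x y w) (h' : X.IsPath x y w') (hc : X.wordChain w = X.wordChain w') :
    X.HomologousWords x y w w' := by
  classical
  let T : ∀ z, X.Path x z := fun z => (hX.2 x z).some
  have hl : X.IsPath x x (w ++ X.invWord w') := h.append h'.invWord
  have hbal : ∀ e, (w ++ X.invWord w').count e = (w ++ X.invWord w').count (X.inv e) := by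
    intro e
    have h₁ := coeff_wordChain (w ++ X.invWord w') e
    rw [wordChain_append, wordChain_invWord, hc, add_neg_cancel, map_zero, Finsupp.zero_apply,
      eq_comm, sub_eq_zero] at h₁
    exact_mod_cast h₁
  have h₁ := homologousWords_flatMap_edgeLoop T hl
  have h₂ := (homologousWords_flatMap_edgeLoop_nil T _ _ le_rfl hbal).append_right (T x).2
  have h₃ := (h₁.trans h₂).append_left (T x).2.invWord
  have h₄ := HomologousWords.invWord_append (T x).2
  have h₅ : X.HomologousWords x x (w ++ X.invWord w') [] := by
    have h₆ := (h₄.append_right hl).symm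
    simp only [List.append_assoc, List.nil_append] at h₃ h₄ h₆
    exact h₆.trans (h₃.trans h₄)
  have h₇ := (HomologousWords.invWord_append h').append_left h
  have h₈ := h₅.append_right h'
  simp only [List.append_assoc, List.append_nil, List.nil_append] at h₇ h₈
  exact h₇.symm.trans h₈

theorem boundary_edgeChain (e : X.E) :
    X.boundary (X.edgeChain e) = Finsupp.single (X.t e) 1 - Finsupp.single (X.s e) 1 :=
  C1.lift_edgeChain X _ _ e

theorem boundary_wordChain {x y : X.V} {w : List X.E} (h : X.IsPath x y w) :
    X.boundary (X.wordChain w) = Finsupp.single y 1 - Finsupp.single x 1 := by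
  induction w generalizing x with
  | nil => cases h; simp [wordChain]
  | cons e w ih =>
    obtain ⟨rfl, h⟩ := h
    rw [wordChain_cons, map_add, ih h, boundary_edgeChain]
    abel

/-- Two atoms are equal if the chains of representing paths are equal. -/
theorem atom_eq_of_wordChain_eq (hX : X.Connected) {x₀ x y : X.V} (γ : X.Path x₀ x)
    (δ : X.Path x₀ y) (hc : X.wordChain γ.1 = X.wordChain δ.1) :
    (⟨x, Quotient.mk _ γ⟩ : X.Atom x₀) = ⟨y, Quotient.mk _ δ⟩ := by
  -- The boundary of the chain of a path from `x₀` determines the end of the path, so `x = y`.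
  have h := congrArg X.boundary hc
  rw [boundary_wordChain γ.2, boundary_wordChain δ.2, sub_left_inj] at h
  obtain rfl := Finsupp.single_left_injective one_ne_zero h
  obtain ⟨_, _, h⟩ := homologousWords_of_wordChain_eq hX γ.2 δ.2 hc
  exact congrArg (Sigma.mk x) (Quotient.sound h)

/-! ### Chains orthogonal to all cycles, and cuts -/

theorem inner_edgeChain_right (c : X.C1) (e : X.E) :
    inner ℝ c (X.edgeChain e) = C1.coeff X c e := by
  classical
  obtain ⟨f, rfl⟩ := X.toC1_surjective c
  induction f using Finsupp.induction_linear with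
  | zero => simp
  | add f g hf hg => simp [inner_add_left, hf, hg]
  | single a r =>
    have h : X.toC1 (Finsupp.single a r) = r • X.edgeChain a := by
      rw [edgeChain, ← map_smul]; simp
    rw [h, real_inner_smul_left, map_smul, Finsupp.smul_apply, smul_eq_mul, inner_edgeChain,
      coeff_edgeChain]
    congr 1
    by_cases h₁ : e = a
    · subst h₁
      simp [(X.inv_ne e).symm]
    · have h₂ : (e = X.inv a) ↔ (a = X.inv e) :=
        ⟨fun h => by rw [h, X.inv_inv], fun h => by rw [h, X.inv_inv]⟩
      simp only [h₁, Ne.symm h₁, if_false, h₂]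
      split_ifs <;> simp

/-- A chain orthogonal to all cycles is the coboundary of a function on the vertices. -/
theorem exists_potential (hX : X.Connected) {c : X.C1} (hc : c ∈ X.Z1ᗮ) :
    ∃ f : X.V → ℝ, ∀ e, C1.coeff X c e = f (X.t e) - f (X.s e) := by
  obtain ⟨x₀⟩ := hX.1
  let T : ∀ z, X.Path x₀ z := fun z => (hX.2 x₀ z).some
  refine ⟨fun z => inner ℝ c (X.wordChain (T z).1), fun e => ?_⟩
  -- The potential integrates `c` along chosen paths; its increment along `e` is the coefficient of
  -- `e` because this chain is closed and `c` pairs to zero with it.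
  have hz : X.wordChain (T (X.t e)).1 - X.wordChain (T (X.s e)).1 - X.edgeChain e ∈ X.Z1 := by
    rw [Z1, LinearMap.mem_ker, map_sub, map_sub, boundary_wordChain (T _).2,
      boundary_wordChain (T _).2, boundary_edgeChain]
    abel
  have h := (Submodule.mem_orthogonal' _ _).1 hc _ hz
  rw [inner_sub_right, inner_sub_right, inner_edgeChain_right] at h
  linarith

noncomputable section

/-- The total boundary of a chain in a set of vertices, i.e. the flux of the chain into the
set. -/
def flux (X : SerreGraph.{u, v}) (S : Set X.V) : X.C1 →ₗ[ℝ] ℝ :=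
  Finsupp.linearCombination ℝ (S.indicator fun _ => (1 : ℝ)) ∘ₗ X.boundary

end

theorem flux_edgeChain (S : Set X.V) (e : X.E) : X.flux S (X.edgeChain e) =
    S.indicator (fun _ => (1 : ℝ)) (X.t e) - S.indicator (fun _ => (1 : ℝ)) (X.s e) := by
  simp [flux, boundary_edgeChain]

theorem flux_wordChain (S : Set X.V) {x y : X.V} {w : List X.E} (h : X.IsPath x y w) :
    X.flux S (X.wordChain w) =
      S.indicator (fun _ => (1 : ℝ)) y - S.indicator (fun _ => (1 : ℝ)) x := by
  simp [flux, boundary_wordChain h]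

/-- The factor 2 appears because `C1.coeff` lists each edge in both orientations, with equal
contributions to the sum. -/
theorem two_mul_flux (S : Set X.V) (c : X.C1) :
    2 * X.flux S c = (C1.coeff X c).sum fun e r => r *
      (S.indicator (fun _ => (1 : ℝ)) (X.t e) - S.indicator (fun _ => (1 : ℝ)) (X.s e)) := by
  have h : X.flux S ∘ₗ X.toC1 = Finsupp.linearCombination ℝ fun e =>
      S.indicator (fun _ => (1 : ℝ)) (X.t e) - S.indicator (fun _ => (1 : ℝ)) (X.s e) := by
    ext e
    simpa [edgeChain] using flux_edgeChain S e
  rw [← smul_eq_mul, ← map_smul, ← C1.toC1_coeff]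
  exact LinearMap.congr_fun h _

/-- A path from a point of `S` to a point outside `S` contains an edge leaving `S`. -/
theorem IsPath.exists_leaving {x y : X.V} {w : List X.E} (h : X.IsPath x y w) {S : Set X.V}
    (hx : x ∈ S) (hy : y ∉ S) : ∃ e : X.E, X.s e ∈ S ∧ X.t e ∉ S := by
  induction w generalizing x with
  | nil => cases h; exact absurd hx hy
  | cons e w ih =>
    obtain ⟨rfl, h⟩ := h
    by_cases he : X.t e ∈ S
    · exact ih h he
    · exact ⟨e, hx, he⟩

/-- In a bridgeless graph, a nonzero chain orthogonal to all cycles crosses some cut, always in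
the same direction, along at least two different edges. -/
theorem exists_cut (hX : X.Connected) (hb : X.Bridgeless) {c : X.C1} (hc : c ∈ X.Z1ᗮ)
    (hne : c ≠ 0) : ∃ (S : Set X.V) (e₁ e₂ : X.E), e₂ ≠ e₁ ∧ e₂ ≠ X.inv e₁ ∧
      (X.t e₁ ∈ S ∧ X.s e₁ ∉ S) ∧ (X.t e₂ ∈ S ∧ X.s e₂ ∉ S) ∧ 0 < C1.coeff X c e₁ ∧
      0 < C1.coeff X c e₂ ∧ C1.coeff X c e₁ + C1.coeff X c e₂ ≤ X.flux S c := by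
  classical
  obtain ⟨f, hf⟩ := exists_potential hX hc
  -- Some coefficient is nonzero; passing to the inverse edge if necessary makes it positive.
  have h₀ : ∃ e, 0 < C1.coeff X c e := by
    by_contra! h
    refine hne (C1.coeff_injective X ?_)
    rw [map_zero]
    ext e
    refine le_antisymm (h e) ?_
    have := h (X.inv e)
    rw [coeff_inv] at this
    simpa using this
  obtain ⟨e₁, he₁⟩ := h₀
  -- A superlevel set of the potential: every edge entering it increases `f`, hence has positive
  -- coefficient. The threshold is chosen so that `e₁` enters it.
  let S : Set X.V := {z | f (X.t e₁) ≤ f z}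
  have ht₁ : X.t e₁ ∈ S := le_refl (f (X.t e₁))
  have hs₁ : X.s e₁ ∉ S := by
    have := hf e₁
    simp only [S, Set.mem_ofPred_eq, not_le]
    linarith
  -- Since `e₁` is not a bridge, some path avoiding it runs from its target back to its source. This
  -- path must leave `S`, and the inverse of the leaving edge serves as `e₂`.
  have hdel : (X.deleteEdge e₁).Connected := not_not.1 (hb e₁)
  obtain ⟨γ⟩ := hdel.2 (X.t e₁) (X.s e₁)
  obtain ⟨⟨e, hee₁, hee₂⟩, hs, ht⟩ := γ.2.exists_leaving (S := S) ht₁ hs₁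
  have hs₂ : X.s e ∈ S := hs
  have ht₂ : X.t e ∉ S := ht
  have hpos : 0 < C1.coeff X c (X.inv e) := by
    rw [hf, X.s_inv, X.t_inv]
    simp only [S, Set.mem_ofPred_eq, not_le] at hs₂ ht₂
    linarith
  have hne₁ : X.inv e ≠ e₁ := fun h => hee₂ (by rw [← h, X.inv_inv])
  have hne₂ : X.inv e ≠ X.inv e₁ := fun h => hee₁ (by rw [← X.inv_inv e, h, X.inv_inv])
  refine ⟨S, e₁, X.inv e, hne₁, hne₂, ⟨ht₁, hs₁⟩, ⟨by rwa [X.t_inv], by rwa [X.s_inv]⟩, he₁,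
    hpos, ?_⟩
  set g : X.E → ℝ := fun a => C1.coeff X c a *
    (S.indicator (fun _ => (1 : ℝ)) (X.t a) - S.indicator (fun _ => (1 : ℝ)) (X.s a)) with hg
  have hg₀ : ∀ a, 0 ≤ g a := by
    intro a
    simp only [hg, hf a, S, Set.indicator_apply, Set.mem_ofPred_eq]
    split_ifs with h₁ h₂ h₂ <;> simp <;> linarith
  -- All terms of twice the flux are nonnegative, so it is bounded below by the terms of the two
  -- crossing edges in both orientations.
  have hsub : ({e₁, X.inv e₁, X.inv e, e} : Finset X.E) ⊆ (C1.coeff X c).support := by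
    have h₁ := coeff_inv c e₁
    have h₂ := coeff_inv c e
    intro a ha
    simp only [Finset.mem_insert, Finset.mem_singleton] at ha
    rw [Finsupp.mem_support_iff]
    rcases ha with rfl | rfl | rfl | rfl <;> intro h <;> linarith
  have hle := Finset.sum_le_sum_of_subset_of_nonneg hsub (f := g) fun a _ _ => hg₀ a
  have h2 := two_mul_flux S c
  rw [Finsupp.sum] at h2
  rw [← h2, Finset.sum_insert, Finset.sum_insert, Finset.sum_insert, Finset.sum_singleton] at hle
  · have h₁ := coeff_inv c e₁
    have h₂ := coeff_inv c e
    simp only [hg, h₁, h₂, X.s_inv, X.t_inv, Set.indicator_of_mem ht₁,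
      Set.indicator_of_notMem hs₁, Set.indicator_of_mem hs₂, Set.indicator_of_notMem ht₂] at hle
    linarith
  · simpa using X.inv_ne e
  · simpa using ⟨hne₂.symm, fun h => hee₂ h.symm⟩
  · simpa using ⟨(X.inv_ne e₁).symm, hne₁.symm, fun h => hee₁ h.symm⟩

/-! ### Points on edges -/

/-- The coefficient of an edge in the chain of a path is an integer. -/
theorem exists_int_coeff_wordChain_sub (w w' : List X.E) (e : X.E) :
    ∃ n : ℤ, C1.coeff X (X.wordChain w - X.wordChain w') e = n := by
  classical
  refine ⟨w.count e - w.count (X.inv e) - (w'.count e - w'.count (X.inv e)), ?_⟩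
  rw [map_sub, Finsupp.sub_apply, coeff_wordChain, coeff_wordChain]
  push_cast
  ring

theorem coeff_edgeChain_self (e : X.E) : C1.coeff X (X.edgeChain e) e = 1 := by
  classical
  simp [coeff_edgeChain, (X.inv_ne e).symm]

theorem coeff_edgeChain_of_ne {e f : X.E} (h : f ≠ e) (h' : f ≠ X.inv e) :
    C1.coeff X (X.edgeChain e) f = 0 := by
  classical
  have : e ≠ X.inv f := fun h => h' (by rw [h, X.inv_inv])
  simp [coeff_edgeChain, this, h.symm]

/-- If `γ` and `δ` are paths to the sources of the edges `e` and `g`, and the chains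
`c_γ + r e` and `c_δ + q g` have the same projection to the cycles, then they agree. -/
theorem wordChain_add_smul_eq (hX : X.Connected) (hb : X.Bridgeless) {x₀ : X.V} {e g : X.E}
    (γ : X.Path x₀ (X.s e)) (δ : X.Path x₀ (X.s g)) {r q : ℝ} (hr : r ∈ Set.Icc (0 : ℝ) 1)
    (hq : q ∈ Set.Icc (0 : ℝ) 1)
    (h : (X.wordChain γ.1 + r • X.edgeChain e) - (X.wordChain δ.1 + q • X.edgeChain g) ∈ X.Z1ᗮ) :
    X.wordChain γ.1 + r • X.edgeChain e = X.wordChain δ.1 + q • X.edgeChain g := by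
  classical
  by_contra hne
  obtain ⟨S, e₁, e₂, h₁₂, h₁₂', ⟨ht₁, hs₁⟩, ⟨ht₂, hs₂⟩, hp₁, hp₂, hle⟩ :=
    exists_cut hX hb h (sub_ne_zero.2 hne)
  set c := (X.wordChain γ.1 + r • X.edgeChain e) - (X.wordChain δ.1 + q • X.edgeChain g) with hc
  obtain ⟨hr₀, hr₁⟩ := hr
  obtain ⟨hq₀, hq₁⟩ := hq
  -- The mass in `S` of the two points.
  obtain ⟨me, hme⟩ : ∃ m, m = (1 - r) * S.indicator (fun _ => (1 : ℝ)) (X.s e) +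
    r * S.indicator (fun _ => (1 : ℝ)) (X.t e) := ⟨_, rfl⟩
  obtain ⟨mg, hmg⟩ : ∃ m, m = (1 - q) * S.indicator (fun _ => (1 : ℝ)) (X.s g) +
    q * S.indicator (fun _ => (1 : ℝ)) (X.t g) := ⟨_, rfl⟩
  -- Both paths start at `x₀`, whose contributions cancel.
  have hflux : X.flux S c = me - mg := by
    rw [hc, map_sub, map_add, map_add, map_smul, map_smul, flux_wordChain S γ.2,
      flux_wordChain S δ.2, flux_edgeChain, flux_edgeChain, hme, hmg, smul_eq_mul, smul_eq_mul]
    ring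
  have hme₁ : me ≤ 1 := by
    simp only [hme, Set.indicator_apply]
    split_ifs <;> linarith
  have hmg₀ : 0 ≤ mg := by
    simp only [hmg, Set.indicator_apply]
    split_ifs <;> linarith
  have hcoeff : ∀ a, ∃ n : ℤ, C1.coeff X c a = n + r * C1.coeff X (X.edgeChain e) a -
      q * C1.coeff X (X.edgeChain g) a := by
    intro a
    obtain ⟨n, hn⟩ := exists_int_coeff_wordChain_sub γ.1 δ.1 a
    refine ⟨n, ?_⟩
    rw [← hn, hc]
    simp only [map_sub, map_add, map_smul, Finsupp.sub_apply, Finsupp.add_apply,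
      Finsupp.smul_apply, smul_eq_mul]
    ring
  have hnone : ∀ a, 0 < C1.coeff X c a → a ≠ e → a ≠ X.inv e → a ≠ g → a ≠ X.inv g →
      1 ≤ C1.coeff X c a := by
    intro a ha h₁ h₂ h₃ h₄
    obtain ⟨n, hn⟩ := hcoeff a
    rw [coeff_edgeChain_of_ne h₁ h₂, coeff_edgeChain_of_ne h₃ h₄, mul_zero, mul_zero, add_zero,
      sub_zero] at hn
    rw [hn] at ha ⊢
    exact_mod_cast (show 0 < n by exact_mod_cast ha)
  -- The coefficient is `n + r` if `a = e` and `n - r` if `a = e⁻¹`. Being positive, it is at least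
  -- `r` or `1 - r` respectively, and this is the mass `me`, since only the target of `a` lies in
  -- `S`.
  have hfirst : ∀ a, 0 < C1.coeff X c a → X.t a ∈ S → X.s a ∉ S → (a = e ∨ a = X.inv e) →
      a ≠ g → a ≠ X.inv g → me ≤ C1.coeff X c a := by
    intro a ha ht hs h₁ h₃ h₄
    obtain ⟨n, hn⟩ := hcoeff a
    rw [coeff_edgeChain_of_ne h₃ h₄, mul_zero, sub_zero] at hn
    rw [hn] at ha ⊢
    rcases h₁ with rfl | rfl
    · rw [coeff_edgeChain_self] at ha ⊢
      have : (-1 : ℝ) < n := by linarith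
      have : (0 : ℝ) ≤ n := by
        have h' : (-1 : ℤ) < n := by exact_mod_cast this
        exact_mod_cast (show (0 : ℤ) ≤ n by omega)
      simp only [hme, Set.indicator_of_mem ht, Set.indicator_of_notMem hs]
      linarith
    · rw [coeff_inv, coeff_edgeChain_self] at ha ⊢
      rw [X.t_inv] at ht
      rw [X.s_inv] at hs
      have : (0 : ℝ) < n := by linarith
      have : (1 : ℝ) ≤ n := by exact_mod_cast (show (0 : ℤ) < n by exact_mod_cast this)
      simp only [hme, Set.indicator_of_mem ht, Set.indicator_of_notMem hs]
      linarith
  -- Here the point on `g` enters with a minus sign, so the lower bound is the mass outside `S`.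
  have hsecond : ∀ a, 0 < C1.coeff X c a → X.t a ∈ S → X.s a ∉ S → a ≠ e → a ≠ X.inv e →
      (a = g ∨ a = X.inv g) → 1 - mg ≤ C1.coeff X c a := by
    intro a ha ht hs h₁ h₂ h₃
    obtain ⟨n, hn⟩ := hcoeff a
    rw [coeff_edgeChain_of_ne h₁ h₂, mul_zero, add_zero] at hn
    rw [hn] at ha ⊢
    rcases h₃ with rfl | rfl
    · rw [coeff_edgeChain_self] at ha ⊢
      have : (0 : ℝ) < n := by linarith
      have : (1 : ℝ) ≤ n := by exact_mod_cast (show (0 : ℤ) < n by exact_mod_cast this)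
      simp only [hmg, Set.indicator_of_mem ht, Set.indicator_of_notMem hs]
      linarith
    · rw [coeff_inv, coeff_edgeChain_self] at ha ⊢
      rw [X.t_inv] at ht
      rw [X.s_inv] at hs
      have : (-1 : ℝ) < n := by linarith
      have : (0 : ℝ) ≤ n := by
        have h' : (-1 : ℤ) < n := by exact_mod_cast this
        exact_mod_cast (show (0 : ℤ) ≤ n by omega)
      simp only [hmg, Set.indicator_of_mem ht, Set.indicator_of_notMem hs]
      linarith
  have hinv := X.inv_inv
  rw [hflux] at hle
  have h₂₁' : e₁ ≠ X.inv e₂ := fun h => h₁₂' (by rw [h, hinv])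
  have hdisj : ∀ {a b f : X.E}, b ≠ a → b ≠ X.inv a → (a = f ∨ a = X.inv f) →
      b ≠ f ∧ b ≠ X.inv f := by
    rintro a b f h₁ h₂ (rfl | rfl)
    · exact ⟨h₁, h₂⟩
    · exact ⟨fun h => h₂ (by rw [hinv, h]), h₁⟩
  -- Either one crossing edge avoids both `e` and `g`, and the sum of the two coefficients exceeds
  -- `1 ≥ me - mg`; or one lies on `e` only and the other on `g` only, and the sum is at least `me +
  -- (1 - mg)`.
  by_cases h₁e : e₁ = e ∨ e₁ = X.inv e
  · obtain ⟨k₁, k₂⟩ := hdisj h₁₂ h₁₂' h₁e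
    by_cases h₂g : e₂ = g ∨ e₂ = X.inv g
    · obtain ⟨k₃, k₄⟩ := hdisj h₁₂.symm h₂₁' h₂g
      have := hfirst e₁ hp₁ ht₁ hs₁ h₁e k₃ k₄
      have := hsecond e₂ hp₂ ht₂ hs₂ k₁ k₂ h₂g
      linarith
    · rw [not_or] at h₂g
      have := hnone e₂ hp₂ k₁ k₂ h₂g.1 h₂g.2
      linarith
  · rw [not_or] at h₁e
    by_cases h₁g : e₁ = g ∨ e₁ = X.inv g
    · obtain ⟨k₁, k₂⟩ := hdisj h₁₂ h₁₂' h₁g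
      by_cases h₂e : e₂ = e ∨ e₂ = X.inv e
      · have := hfirst e₂ hp₂ ht₂ hs₂ h₂e k₁ k₂
        have := hsecond e₁ hp₁ ht₁ hs₁ h₁e.1 h₁e.2 h₁g
        linarith
      · rw [not_or] at h₂e
        have := hnone e₂ hp₂ h₂e.1 h₂e.2 k₁ k₂
        linarith
    · rw [not_or] at h₁g
      have := hnone e₁ hp₁ h₁e.1 h₁e.2 h₁g.1 h₁g.2
      linarith

/-! ### Maps out of the geometric realization -/

namespace Realization

theorem param_zero (e : X.E) : param X e 0 = vertex X (X.s e) := Quot.sound (.source e)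

theorem param_one (e : X.E) : param X e 1 = vertex X (X.t e) := Quot.sound (.target e)

theorem param_inv (e : X.E) (r : unitInterval) :
    param X (X.inv e) (unitInterval.symm r) = param X e r :=
  (Quot.sound (.inverse e r)).symm

@[elab_as_elim]
theorem ind {motive : X.Realization → Prop} (vertex : ∀ x, motive (vertex X x))
    (param : ∀ e r, motive (param X e r)) (p : X.Realization) : motive p := by
  induction p using Quot.ind with
  | _ p =>
    rcases p with ⟨x, ⟨⟩⟩ | ⟨e, r⟩
    · exact vertex x
    · exact param e r

variable {W : Type*} [AddCommGroup W] [Module ℝ W]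

/-- The extension of a map from the vertices to a real vector space to a map which is affine
on bonds. -/
def affineExtension (i : X.V → W) : X.Realization → W :=
  Quot.lift (Sum.elim (fun x => i x.1)
    (fun b => i (X.s b.1) + (b.2 : ℝ) • (i (X.t b.1) - i (X.s b.1)))) <| by
    intro a b h
    cases h with
    | source e => simp
    | target e => simp
    | inverse e r =>
      simp only [Sum.elim_inr, X.s_inv, X.t_inv, unitInterval.coe_symm_eq]
      module

theorem affineExtension_vertex (i : X.V → W) (x : X.V) :
    affineExtension i (vertex X x) = i x := rfl

theorem affineExtension_param (i : X.V → W) (e : X.E) (r : unitInterval) :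
    affineExtension i (param X e r) = i (X.s e) + (r : ℝ) • (i (X.t e) - i (X.s e)) := rfl

theorem affineOnBonds_affineExtension (i : X.V → W) : X.AffineOnBonds (affineExtension i) :=
  fun e => ⟨_, _, affineExtension_param i e⟩

/-- Evaluation at `r = 0` and `r = 1` determines the coefficients `a` and `b` on each edge. -/
theorem eq_affineExtension {i : X.V → W} {j : X.Realization → W}
    (hv : ∀ x, j (vertex X x) = i x) (hj : X.AffineOnBonds j) : j = affineExtension i := by
  funext p
  induction p using ind with
  | vertex x => exact hv x
  | param e r =>
    obtain ⟨a, b, h⟩ := hj e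
    have h₀ := h 0
    have h₁ := h 1
    rw [param_zero, hv] at h₀
    rw [param_one, hv] at h₁
    rw [affineExtension_param, h, h₀, h₁]
    simp

theorem continuous_affineExtension [TopologicalSpace W] [ContinuousAdd W] [ContinuousSMul ℝ W]
    (i : X.V → W) : Continuous (affineExtension i) := by
  refine continuous_quot_lift _ (Continuous.sumElim ?_ ?_)
  · exact continuous_sigma fun x => (continuous_const : Continuous fun _ : Unit => i x)
  · exact continuous_sigma fun e => by dsimp only; fun_prop

end Realization

/-! ### The crystal map -/

/-- This lets vertices of the cover be treated as points on edges with parameter 0. -/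
theorem exists_edge_from (hX : X.Connected) (hE : Nonempty X.E) (x : X.V) :
    ∃ e, X.s e = x := by
  obtain ⟨e⟩ := hE
  obtain ⟨⟨w, hw⟩⟩ := hX.2 x (X.s e)
  cases w with
  | nil => exact ⟨e, Eq.symm hw⟩
  | cons f w => exact ⟨f, hw.1⟩

theorem atomMap_mk (x₀ : X.V) [X.Z1.HasOrthogonalProjection] {x : X.V} (γ : X.Path x₀ x) :
    X.atomMap x₀ ⟨x, Quotient.mk _ γ⟩ = X.Z1.orthogonalProjectionOnto (X.wordChain γ.1) := rfl

/-- A point on an edge of the maximal abelian cover. -/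
noncomputable def coverPoint {x₀ : X.V} (e : X.E) (γ : X.Path x₀ (X.s e)) (r : unitInterval) :
    (X.maxAbelianCover x₀).Realization :=
  Realization.param (X.maxAbelianCover x₀) (⟨e, Quotient.mk _ γ⟩ : X.CoverEdge x₀) r

theorem affineExtension_atomMap_coverPoint {x₀ : X.V} [X.Z1.HasOrthogonalProjection] (e : X.E)
    (γ : X.Path x₀ (X.s e)) (r : unitInterval) :
    Realization.affineExtension (X := X.maxAbelianCover x₀) (X.atomMap x₀) (coverPoint e γ r) =
      X.Z1.orthogonalProjectionOnto (X.wordChain γ.1 + (r : ℝ) • X.edgeChain e) := by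
  have h : X.atomMap x₀ ⟨X.t e, Quotient.mk _ (γ.snoc e rfl rfl)⟩ =
      X.Z1.orthogonalProjectionOnto (X.wordChain γ.1 + X.edgeChain e) := by
    rw [atomMap_mk, Path.snoc, wordChain_append, wordChain_cons]
    simp [wordChain]
  change X.atomMap x₀ ⟨X.s e, Quotient.mk _ γ⟩ + (r : ℝ) •
    (X.atomMap x₀ ⟨X.t e, Quotient.mk _ (γ.snoc e rfl rfl)⟩ -
      X.atomMap x₀ ⟨X.s e, Quotient.mk _ γ⟩) = _
  rw [h, atomMap_mk, map_add, map_add, map_smul, add_sub_cancel_left]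

theorem coverPoint_zero {x₀ : X.V} (e : X.E) (γ : X.Path x₀ (X.s e)) :
    coverPoint e γ 0 = Realization.vertex (X.maxAbelianCover x₀)
      (⟨X.s e, Quotient.mk _ γ⟩ : X.Atom x₀) :=
  Realization.param_zero (X := X.maxAbelianCover x₀) _

theorem coverPoint_one {x₀ : X.V} (e : X.E) (γ : X.Path x₀ (X.s e)) :
    coverPoint e γ 1 = Realization.vertex (X.maxAbelianCover x₀)
      (⟨X.t e, Quotient.mk _ (γ.snoc e rfl rfl)⟩ : X.Atom x₀) :=
  Realization.param_one (X := X.maxAbelianCover x₀) _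

theorem coverPoint_symm {x₀ : X.V} (e : X.E) (γ : X.Path x₀ (X.s e)) (r : unitInterval) :
    coverPoint (X.inv e) (γ.snoc e rfl (X.s_inv e).symm) (unitInterval.symm r) =
      coverPoint e γ r :=
  Realization.param_inv (X := X.maxAbelianCover x₀) (⟨e, Quotient.mk _ γ⟩ : X.CoverEdge x₀) r

/-- A point at an end of an edge of the cover is the vertex given by some path. -/
theorem exists_coverPoint_eq_vertex {x₀ : X.V} (e : X.E) (γ : X.Path x₀ (X.s e))
    {r : unitInterval} (hr : r = 0 ∨ r = 1) : ∃ (x : X.V) (γ' : X.Path x₀ x),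
      coverPoint e γ r = Realization.vertex (X.maxAbelianCover x₀)
        (⟨x, Quotient.mk _ γ'⟩ : X.Atom x₀) ∧
      X.wordChain γ'.1 = X.wordChain γ.1 + (r : ℝ) • X.edgeChain e := by
  rcases hr with rfl | rfl
  · exact ⟨_, γ, coverPoint_zero e γ, by simp⟩
  · refine ⟨_, γ.snoc e rfl rfl, coverPoint_one e γ, ?_⟩
    simp [Path.snoc, wordChain]

/-- Comparing coefficients at `e` shows that `q - r` is an integer. It has absolute value less than
1 because `r` is interior, so `q = r` and the two paths have the same chain. -/
theorem coverPoint_eq_of_edge_eq (hX : X.Connected) {x₀ : X.V} {e : X.E}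
    (γ δ : X.Path x₀ (X.s e)) {r q : unitInterval} (hr : ¬ (r = 0 ∨ r = 1))
    (h : X.wordChain γ.1 + (r : ℝ) • X.edgeChain e = X.wordChain δ.1 + (q : ℝ) • X.edgeChain e) :
    coverPoint e γ r = coverPoint e δ q := by
  obtain ⟨n, hn⟩ := exists_int_coeff_wordChain_sub γ.1 δ.1 e
  have h₁ : X.wordChain γ.1 - X.wordChain δ.1 = ((q : ℝ) - r) • X.edgeChain e := by
    rw [sub_smul, sub_eq_sub_iff_add_eq_add, h, add_comm]
  rw [h₁, map_smul, Finsupp.smul_apply, coeff_edgeChain_self, smul_eq_mul, mul_one] at hn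
  rw [not_or] at hr
  have hr₀ : (0 : ℝ) < r := unitInterval.pos_iff_ne_zero.2 hr.1
  have hr₁ : (r : ℝ) < 1 := unitInterval.lt_one_iff_ne_one.2 hr.2
  have hq₀ := q.2.1
  have hq₁ := q.2.2
  have hn₀ : n = 0 := by
    have k₁ : (n : ℝ) < 1 := by linarith
    have k₂ : (-1 : ℝ) < n := by linarith
    have k₁ : n < 1 := by exact_mod_cast k₁
    have k₂ : -1 < n := by exact_mod_cast k₂
    omega
  obtain rfl : q = r := by
    rw [hn₀, Int.cast_zero, sub_eq_zero] at hn
    exact Subtype.ext hn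
  have h₂ := atom_eq_of_wordChain_eq hX γ δ (add_right_cancel h)
  have h₃ := eq_of_heq (Sigma.mk.inj h₂).2
  rw [coverPoint, h₃, coverPoint]

/-- The chain on the left has a non-integral coefficient at `e`, which forces `g` to be `e` or
`e⁻¹`; the second case reduces to the first by reversing the parametrization. -/
theorem coverPoint_eq_of_interior (hX : X.Connected) {x₀ : X.V} {e g : X.E}
    (γ : X.Path x₀ (X.s e)) (δ : X.Path x₀ (X.s g)) {r q : unitInterval}
    (hr : ¬ (r = 0 ∨ r = 1))
    (h : X.wordChain γ.1 + (r : ℝ) • X.edgeChain e = X.wordChain δ.1 + (q : ℝ) • X.edgeChain g) :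
    coverPoint e γ r = coverPoint g δ q := by
  by_cases h₁ : e = g
  · subst h₁
    exact coverPoint_eq_of_edge_eq hX γ δ hr h
  by_cases h₂ : e = X.inv g
  · subst h₂
    rw [← coverPoint_symm g]
    refine coverPoint_eq_of_edge_eq hX _ _ hr ?_
    rw [h, edgeChain_inv, unitInterval.coe_symm_eq, Path.snoc, wordChain_append, wordChain_cons]
    simp only [wordChain, List.map_nil, List.sum_nil]
    module
  · exfalso
    obtain ⟨n, hn⟩ := exists_int_coeff_wordChain_sub δ.1 γ.1 e
    have h₃ : X.wordChain δ.1 - X.wordChain γ.1 = (r : ℝ) • X.edgeChain e -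
        (q : ℝ) • X.edgeChain g := by
      rw [sub_eq_sub_iff_add_eq_add, ← h, add_comm]
    rw [h₃, map_sub, map_smul, map_smul, Finsupp.sub_apply, Finsupp.smul_apply,
      Finsupp.smul_apply, coeff_edgeChain_self, coeff_edgeChain_of_ne h₁ h₂, smul_eq_mul,
      smul_eq_mul, mul_one, mul_zero, sub_zero] at hn
    rw [not_or] at hr
    have hr₀ : (0 : ℝ) < r := unitInterval.pos_iff_ne_zero.2 hr.1
    have hr₁ : (r : ℝ) < 1 := unitInterval.lt_one_iff_ne_one.2 hr.2
    rw [hn] at hr₀ hr₁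
    have k₁ : 0 < n := by exact_mod_cast hr₀
    have k₂ : n < 1 := by exact_mod_cast hr₁
    omega

theorem coverPoint_eq (hX : X.Connected) {x₀ : X.V} {e g : X.E}
    (γ : X.Path x₀ (X.s e)) (δ : X.Path x₀ (X.s g)) {r q : unitInterval}
    (h : X.wordChain γ.1 + (r : ℝ) • X.edgeChain e = X.wordChain δ.1 + (q : ℝ) • X.edgeChain g) :
    coverPoint e γ r = coverPoint g δ q := by
  by_cases hr : r = 0 ∨ r = 1
  -- If both points are vertices, their edges may well differ, so the representing paths are
  -- compared instead.
  · by_cases hq : q = 0 ∨ q = 1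
    · obtain ⟨x, γ', h₁, h₂⟩ := exists_coverPoint_eq_vertex e γ hr
      obtain ⟨y, δ', h₃, h₄⟩ := exists_coverPoint_eq_vertex g δ hq
      rw [h₁, h₃, atom_eq_of_wordChain_eq hX γ' δ' (by rw [h₂, h₄, h])]
    · exact (coverPoint_eq_of_interior hX δ γ hq h.symm).symm
  · exact coverPoint_eq_of_interior hX γ δ hr h

theorem exists_eq_coverPoint (hX : X.Connected) (hE : Nonempty X.E) {x₀ : X.V}
    (p : (X.maxAbelianCover x₀).Realization) :
    ∃ (e : X.E) (γ : X.Path x₀ (X.s e)) (r : unitInterval), p = coverPoint e γ r := by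
  induction p using Realization.ind with
  | vertex a =>
    obtain ⟨x, a⟩ := a
    induction a using Quotient.inductionOn with
    | _ γ =>
      obtain ⟨e, rfl⟩ := exists_edge_from hX hE x
      exact ⟨e, γ, 0, (coverPoint_zero e γ).symm⟩
  | param b r =>
    obtain ⟨e, a⟩ := b
    induction a using Quotient.inductionOn with
    | _ γ => exact ⟨e, γ, r, rfl⟩

theorem injective_affineExtension_atomMap (hX : X.Connected) (hb : X.Bridgeless) (x₀ : X.V)
    [X.Z1.HasOrthogonalProjection] : Function.Injective
      (Realization.affineExtension (X := X.maxAbelianCover x₀) (X.atomMap x₀)) := by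
  intro p p' h
  by_cases hE : Nonempty X.E
  · obtain ⟨e, γ, r, rfl⟩ := exists_eq_coverPoint hX hE p
    obtain ⟨g, δ, q, rfl⟩ := exists_eq_coverPoint hX hE p'
    rw [affineExtension_atomMap_coverPoint, affineExtension_atomMap_coverPoint, ← sub_eq_zero,
      ← map_sub, Submodule.orthogonalProjectionOnto_eq_zero_iff] at h
    exact coverPoint_eq hX γ δ (wordChain_add_smul_eq hX hb γ δ r.2 q.2 h)
  -- Without edges, the realization consists of vertices only and every path is empty, so all chains
  -- vanish.
  · have hw : ∀ w : List X.E, w = [] := by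
      rintro (_ | ⟨e, w⟩)
      · rfl
      · exact absurd ⟨e⟩ hE
    have hv : ∀ p : (X.maxAbelianCover x₀).Realization, ∃ (x : X.V) (γ : X.Path x₀ x),
        p = Realization.vertex (X.maxAbelianCover x₀) (⟨x, Quotient.mk _ γ⟩ : X.Atom x₀) := by
      intro p
      induction p using Realization.ind with
      | vertex a =>
        obtain ⟨x, a⟩ := a
        induction a using Quotient.inductionOn with
        | _ γ => exact ⟨x, γ, rfl⟩
      | param b r => exact absurd ⟨b.1⟩ hE
    obtain ⟨x, γ, rfl⟩ := hv p
    obtain ⟨y, δ, rfl⟩ := hv p'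
    rw [atom_eq_of_wordChain_eq hX γ δ (by rw [hw γ.1, hw δ.1])]

end SerreGraph

theorem mainTheorem1 (X : SerreGraph) (hX : X.Connected) (x₀ : X.V)
    [X.Z1.HasOrthogonalProjection] :
    (∃! j : (X.maxAbelianCover x₀).Realization → X.Z1, X.IsCrystalMap x₀ j) ∧
      ∀ j : (X.maxAbelianCover x₀).Realization → X.Z1, X.IsCrystalMap x₀ j →
        Continuous j ∧ (X.Bridgeless → Function.Injective j) := by
  have huniq : ∀ j, X.IsCrystalMap x₀ j → j = SerreGraph.Realization.affineExtension
      (X := X.maxAbelianCover x₀) (X.atomMap x₀) :=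
    fun j hj => SerreGraph.Realization.eq_affineExtension hj.1 hj.2
  refine ⟨⟨_, ⟨SerreGraph.Realization.affineExtension_vertex (X := X.maxAbelianCover x₀) _,
    SerreGraph.Realization.affineOnBonds_affineExtension _⟩, huniq⟩, fun j hj => ?_⟩
  rw [huniq j hj]
  exact ⟨SerreGraph.Realization.continuous_affineExtension _,
    fun hb => SerreGraph.injective_affineExtension_atomMap hX hb x₀⟩
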